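/- Differential polynomials. Let \(\mathcal D=\mathbb R\langle Q,Q^{-1},Q_x,Q_{xx},\dots\rangle\) be the associative unital real algebra generated by the noncommuting letters \(Q^{-1}\) and \(Q=\partial_x^0Q,\ Q_x=\partial_xQ,\ Q_{xx}=\partial_x^2Q,\dots\), subject only to \(QQ^{-1}=Q^{-1}Q=1\). Let \(D\) be the derivation of \(\mathcal D\) with \(D(\partial_x^jQ)=\partial_x^{j+1}Q\) and \(D(Q^{-1})=-Q^{-1}Q_xQ^{-1}\). For \(G\in\mathcal D\), let \(D^{-1}G\) denote the element \(F\in\mathcal D\) with \(DF=G\) that has no derivative-free part, i.e. that lies in the two-sided ideal generated by \(Q_x,Q_{xx},\dots\), if such an \(F\) exists (no constants of integration). Put \(V=Q_xQ^{-1}\), \(C_VF=VF-FV\), \(A_VF=VF+FV\), \(R_GF=FG\), and \[ \Phi(Q)=R_Q\,D^{-1}(D+C_V)(D-A_VD^{-1}A_V)(D-C_V)\,R_{Q^{-1}} . \] The meta-mKdV hierarchy consists of the equations \[ Q_{t_{2n-1}}=\Phi(Q)^{n-1}Q_x ,\qquad n\ge 1,\qquad x=t_1 . \] Theorem. (i)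 All the elements \(K_n=\Phi(Q)^{n-1}Q_x\in\mathcal D\), \(n\ge1\), exist (i.e. each \(D^{-1}\) in their construction exists) and are unique. (ii) Let \(\mathcal A\) be a real or complex unital Banach algebra with unit \(I\), let \(A,B\in\mathcal A\) with \(A\) invertible, let \(N\ge1\), and for \((t_1,t_3,\dots,t_{2N-1})\in\mathbb R^N\) put \[ L_N(t_1,t_3,\dots,t_{2N-1})=\exp\Big(\sum_{k=1}^N A^{2k-1}t_{2k-1}\Big)B . \] Then \(\Omega=\{(t_1,t_3,\dots,t_{2N-1})\in\mathbb R^N : I-L_N \text{ and } I+L_N \text{ are invertible}\}\) is open, and \[ Q_N=(I-L_N)^{-1}A^{-1}(I+L_N) \] is on \(\Omega\) a smooth function with invertible values that solves the system of the first \(N\) equations \(Q_{t_{2n-1}}=\Phi(Q)^{n-1}Q_x\), \(1\le n\le N\), of the meta-mKdV hierarchy; that is, for \(1\le n\le N\) and at every point of \(\Omega\), \(\partial Q_N/\partial t_{2n-1}\) equals the value of \(K_n\) at \(Q=Q_N\), \(Q^{-1}=Q_N^{-1}\), \(\partial_x^jQ=\partial^jQ_N/\partial t_1^j\). -/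

import Mathlib

open scoped ContDiff

namespace MetaMKdV

/-! ### Noncommutative differential polynomials in `Q`, `Q⁻¹`, `Q_x`, `Q_xx`, … -/

/-- The generators: `q j` stands for `∂ₓʲ Q` (so `q 0` is `Q` itself), `qinv` for `Q⁻¹`. -/
inductive Gen : Type
  | q (j : ℕ)
  | qinv

/-- The only relations: `Q Q⁻¹ = 1` and `Q⁻¹ Q = 1`. -/
inductive Rel : FreeAlgebra ℝ Gen → FreeAlgebra ℝ Gen → Prop
  | mul_inv : Rel (FreeAlgebra.ι ℝ (Gen.q 0) * FreeAlgebra.ι ℝ Gen.qinv) 1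
  | inv_mul : Rel (FreeAlgebra.ι ℝ Gen.qinv * FreeAlgebra.ι ℝ (Gen.q 0)) 1

/-- The associative unital real algebra of differential polynomials
`ℝ⟨Q, Q⁻¹, Q_x, Q_xx, …⟩`, in noncommuting letters. -/
def DiffPoly : Type := RingQuot Rel

noncomputable instance : Semiring DiffPoly :=
  inferInstanceAs (Semiring (RingQuot Rel))

noncomputable instance : Algebra ℝ DiffPoly :=
  inferInstanceAs (Algebra ℝ (RingQuot Rel))

noncomputable instance : Ring DiffPoly :=
  Algebra.semiringToRing ℝ

/-- The quotient map. -/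
noncomputable def mk : FreeAlgebra ℝ Gen →ₐ[ℝ] DiffPoly := RingQuot.mkAlgHom ℝ Rel

/-- The differential polynomial `∂ₓʲ Q`. -/
noncomputable def q (j : ℕ) : DiffPoly := mk (FreeAlgebra.ι ℝ (Gen.q j))

/-- The differential polynomial `Q⁻¹`. -/
noncomputable def qinv : DiffPoly := mk (FreeAlgebra.ι ℝ Gen.qinv)

theorem q_mul_qinv : q 0 * qinv = 1 := by
  rw [q, qinv, ← map_mul, ← map_one mk]
  exact RingQuot.mkAlgHom_rel ℝ Rel.mul_inv

theorem qinv_mul_q : qinv * q 0 = 1 := by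
  rw [q, qinv, ← map_mul, ← map_one mk]
  exact RingQuot.mkAlgHom_rel ℝ Rel.inv_mul

section Lift

variable {S : Type*} [Ring S] [Algebra ℝ S]

/-- The universal property of `DiffPoly`. -/
noncomputable def lift (f : Gen → S) (h₁ : f (Gen.q 0) * f Gen.qinv = 1)
    (h₂ : f Gen.qinv * f (Gen.q 0) = 1) : DiffPoly →ₐ[ℝ] S :=
  RingQuot.liftAlgHom ℝ (s := Rel) ⟨FreeAlgebra.lift ℝ f, by
    intro x y h
    cases h <;> simp [h₁, h₂]⟩

theorem lift_mk (f : Gen → S) (h₁ : f (Gen.q 0) * f Gen.qinv = 1)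
    (h₂ : f Gen.qinv * f (Gen.q 0) = 1) (x : FreeAlgebra ℝ Gen) :
    lift f h₁ h₂ (mk x) = FreeAlgebra.lift ℝ f x :=
  RingQuot.liftAlgHom_mkAlgHom_apply ℝ _ _ x

theorem hom_ext {f g : DiffPoly →ₐ[ℝ] S} (h : ∀ j, f (q j) = g (q j))
    (h' : f qinv = g qinv) : f = g := by
  refine RingQuot.ringQuot_ext' ℝ (s := Rel) f g (FreeAlgebra.hom_ext (funext fun x => ?_))
  cases x
  · exact h _
  · exact h'

end Lift

section Eval

variable {S : Type*} [Ring S] [Algebra ℝ S]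

/-- The values of the generators at an invertible element `u` (the value of `Q`) and a sequence
`j` (whose entry `j i`, `i ≥ 1`, is the value of `∂ₓⁱ Q`; the entry `j 0` is not used). -/
def genVal (u : Sˣ) (j : ℕ → S) : Gen → S
  | Gen.q 0 => u
  | Gen.q (i + 1) => j (i + 1)
  | Gen.qinv => (u⁻¹ : Sˣ)

/-- Evaluation of differential polynomials: the algebra homomorphism with `Q ↦ u`, `Q⁻¹ ↦ u⁻¹`
and `∂ₓⁱ Q ↦ j i` for `i ≥ 1`. -/
noncomputable def eval (u : Sˣ) (j : ℕ → S) : DiffPoly →ₐ[ℝ] S :=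
  lift (genVal u j) (by simp [genVal]) (by simp [genVal])

end Eval

/-- The values of the generators under `F ↦ (F, D F)`, with `D (∂ₓʲ Q) = ∂ₓʲ⁺¹ Q` and
`D (Q⁻¹) = -Q⁻¹ Q_x Q⁻¹`. -/
noncomputable def genDeriv : Gen → TrivSqZeroExt DiffPoly DiffPoly
  | Gen.q j => (q j, q (j + 1))
  | Gen.qinv => (qinv, -(qinv * q 1 * qinv))

/-- The homomorphism `F ↦ F + ε D F` to the algebra of dual numbers over `DiffPoly`. -/
noncomputable def derivHom : DiffPoly →ₐ[ℝ] TrivSqZeroExt DiffPoly DiffPoly :=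
  lift genDeriv
    (by
      refine TrivSqZeroExt.ext q_mul_qinv ?_
      change q 0 * -(qinv * q 1 * qinv) + q 1 * qinv = 0
      rw [mul_neg, mul_assoc qinv, ← mul_assoc (q 0), q_mul_qinv, one_mul, neg_add_cancel])
    (by
      refine TrivSqZeroExt.ext qinv_mul_q ?_
      change qinv * q 1 + -(qinv * q 1 * qinv) * q 0 = 0
      rw [neg_mul, mul_assoc (qinv * q 1), qinv_mul_q, mul_one, add_neg_cancel])

theorem derivHom_q (j : ℕ) : derivHom (q j) = (q j, q (j + 1)) := by
  simp only [derivHom, q, lift_mk, FreeAlgebra.lift_ι_apply]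
  rfl

theorem derivHom_qinv : derivHom qinv = (qinv, -(qinv * q 1 * qinv)) := by
  simp only [derivHom, qinv, lift_mk, FreeAlgebra.lift_ι_apply]
  rfl

/-- The total derivative `D = d/dx` of differential polynomials. -/
noncomputable def D (F : DiffPoly) : DiffPoly := (derivHom F).snd

theorem fst_derivHom (F : DiffPoly) : (derivHom F).fst = F := by
  have h : (TrivSqZeroExt.fstHom ℝ DiffPoly DiffPoly).comp derivHom = AlgHom.id ℝ DiffPoly := by
    apply hom_ext
    · intro j
      rw [AlgHom.comp_apply, derivHom_q]
      rfl
    · rw [AlgHom.comp_apply, derivHom_qinv]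
      rfl
  exact DFunLike.congr_fun h F

theorem D_add (F G : DiffPoly) : D (F + G) = D F + D G := by
  simp [D]

theorem D_smul (c : ℝ) (F : DiffPoly) : D (c • F) = c • D F := by
  simp [D]

/-- The product rule. -/
theorem D_mul (F G : DiffPoly) : D (F * G) = D F * G + F * D G := by
  simp only [D, map_mul, TrivSqZeroExt.snd_mul, fst_derivHom]
  exact add_comm _ _

theorem D_q (j : ℕ) : D (q j) = q (j + 1) := by
  rw [D, derivHom_q]
  rfl

theorem D_qinv : D qinv = -(qinv * q 1 * qinv) := by
  rw [D, derivHom_qinv]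
  rfl

/-! ### The recursion operator and the hierarchy -/

/-- The invertible element `T` of the algebra `ℝ[T, T⁻¹]`. -/
noncomputable def unitT : (LaurentPolynomial ℝ)ˣ where
  val := LaurentPolynomial.T 1
  inv := LaurentPolynomial.T (-1)
  val_inv := by rw [← LaurentPolynomial.T_add]; simp
  inv_val := by rw [← LaurentPolynomial.T_add]; simp

/-- The derivative-free part of a differential polynomial, in `ℝ[Q, Q⁻¹]`: all `∂ₓʲ Q` with
`j ≥ 1` are put equal to `0`. Its kernel is the two-sided ideal generated by
`Q_x, Q_xx, …`. -/
noncomputable def derivFreePart : DiffPoly →ₐ[ℝ] LaurentPolynomial ℝ :=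
  eval unitT 0

/-- `IsAntideriv G F` says `F = D⁻¹ G`: `F` is the primitive of `G` without derivative-free part
(no constant of integration). -/
def IsAntideriv (G F : DiffPoly) : Prop := D F = G ∧ derivFreePart F = 0

/-- `V = Q_x Q⁻¹`. -/
noncomputable def V : DiffPoly := q 1 * qinv

/-- The commutator operator `C_V`. -/
noncomputable def C (F : DiffPoly) : DiffPoly := V * F - F * V

/-- The anti-commutator operator `A_V`. -/
noncomputable def AC (F : DiffPoly) : DiffPoly := V * F + F * V

/-- `IsPhi K K'` says that `K' = Φ(Q) K`, where
`Φ(Q) = R_Q D⁻¹ (D + C_V) (D - A_V D⁻¹ A_V) (D - C_V) R_{Q⁻¹}`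
(in particular both antiderivatives exist). Here `W = (D - C_V) R_{Q⁻¹} K`, `F = D⁻¹ A_V W`,
`X = (D - A_V D⁻¹ A_V) W` and `G = D⁻¹ (D + C_V) X`. -/
def IsPhi (K K' : DiffPoly) : Prop :=
  ∃ W F X G : DiffPoly,
    W = D (K * qinv) - C (K * qinv) ∧
    IsAntideriv (AC W) F ∧
    X = D W - AC F ∧
    IsAntideriv (D X + C X) G ∧
    K' = G * q 0

/-- `K n = Φ(Q)ⁿ Q_x` for all `n ≥ 0`. The right-hand side of the hierarchy equation for
`Q_{t_{2n+1}}` is `K n`. -/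
def IsHierarchy (K : ℕ → DiffPoly) : Prop :=
  K 0 = q 1 ∧ ∀ n, IsPhi (K n) (K (n + 1))

/-! ### Solutions with values in a Banach algebra -/

section Solutions

variable {𝒜 : Type*} [NormedRing 𝒜] [NormedAlgebra ℝ 𝒜] {N : ℕ}

/-- The partial derivative in the `n`-th of the variables `t : Fin N → ℝ`. -/
noncomputable def pderiv (n : Fin N) (Q : (Fin N → ℝ) → 𝒜) : (Fin N → ℝ) → 𝒜 :=
  fun t => lineDeriv ℝ Q t (Pi.single n 1)

/-- `Q` solves on the open set `Ω` the system of the equations `Q_{t_{2n+1}} = K n`, `n < N`.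
The coordinate `t n` is the time `t_{2n+1}`; the coordinate `t 0` is `t_1 = x`. -/
def IsSolutionOn [NeZero N] (K : ℕ → DiffPoly) (Ω : Set (Fin N → ℝ))
    (Q : (Fin N → ℝ) → 𝒜) : Prop :=
  IsOpen Ω ∧ ContDiffOn ℝ ∞ Q Ω ∧
    ∀ t ∈ Ω, ∃ u : 𝒜ˣ, (u : 𝒜) = Q t ∧
      ∀ n : Fin N, pderiv n Q t = eval u (fun j => ((pderiv 0)^[j] Q) t) (K n)

/-- `L_N(t_1, …, t_{2N-1}) = exp(∑ₖ A^{2k-1} t_{2k-1}) B`. -/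
noncomputable def solitonL (A B : 𝒜) (t : Fin N → ℝ) : 𝒜 :=
  NormedSpace.exp (∑ k : Fin N, t k • A ^ (2 * (k : ℕ) + 1)) * B

/-- The set `Ω` on which `I ± L_N` are invertible. -/
def solitonDomain (A B : 𝒜) (N : ℕ) : Set (Fin N → ℝ) :=
  {t | IsUnit (1 - solitonL A B t) ∧ IsUnit (1 + solitonL A B t)}

/-- `Q_N = (I - L_N)⁻¹ A⁻¹ (I + L_N)`. -/
noncomputable def solitonQ (A : 𝒜ˣ) (B : 𝒜) (t : Fin N → ℝ) : 𝒜 :=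
  Ring.inverse (1 - solitonL (A : 𝒜) B t) * ((A⁻¹ : 𝒜ˣ) : 𝒜) * (1 + solitonL (A : 𝒜) B t)

end Solutions

end MetaMKdV

namespace MetaMKdV

open Polynomial

/-! ### The kernel of `D` -/

/-! Existence and the explicit solutions rest on one object, the resolvent M = σ + 2 ∑ P_k z^{-k-1}
of ψ_x = (zσ/2 + diag(V, -V)) ψ with M² = 1, where σ is `swap`. With ∇X = DX - [diag(V, -V), X],
comparing powers of z in M_x = [zσ/2 + diag(V, -V), M] gives [σ, P_{k+1}] = 2∇P_k, and M² = 1 gives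
σP_{k+1} + P_{k+1}σ = -2 ∑_{i+j=k} P_i P_j. Half their sum is a recursion free of integration
(`resolvent`); `anticommute_and_commute` is the consistency that recovers both equations from it.
Read entrywise, the commutator equations exhibit every antiderivative in Φ as a combination of
entries of the P_k, so that Φ carries P_k(0,0) Q to P_{k+2}(0,0) Q (`isPhi_resolvent`), and the
hierarchy is P_{2n}(0,0) Q, n ≥ 0.

Uniqueness says that D is injective on elements without derivative-free part. This is an sl₂
argument: for a derivation E that lowers the number of derivatives by one, [E, D] is twice that
number, so a homogeneous element of positive degree killed by D and by a suitable power of E is zero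
(`eq_zero_of_D_eq_zero`).

For the soliton Q_N the resolvent is explicit: P_k = R H^k σ (H - R H a) with a = diag(I - L, I +
L), R = a⁻¹ and H off-diagonal with both entries A. It satisfies the same recursion with the same
start (`dressed_succ`, `eval_resolvent`), and its (0,0) entry at index 2n is the logarithmic
derivative Q_t Q⁻¹ in the corresponding time (`pderiv_solitonQ`, `dressed_entry`). -/

theorem induction {P : DiffPoly → Prop} (h_const : ∀ r : ℝ, P (algebraMap ℝ DiffPoly r))
    (h_q : ∀ j, P (q j)) (h_qinv : P qinv) (h_add : ∀ F G, P F → P G → P (F + G))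
    (h_mul : ∀ F G, P F → P G → P (F * G)) (F : DiffPoly) : P F := by
  obtain ⟨x, rfl⟩ := RingQuot.mkAlgHom_surjective ℝ Rel F
  change P (mk x)
  induction x using FreeAlgebra.induction with
  | grade0 r => rw [AlgHom.commutes]; exact h_const r
  | grade1 g => cases g with
    | q j => exact h_q j
    | qinv => exact h_qinv
  | mul a b ha hb => rw [map_mul]; exact h_mul _ _ ha hb
  | add a b ha hb => rw [map_add]; exact h_add _ _ ha hb

section Lift

variable {S : Type*} [Ring S] [Algebra ℝ S] (f : Gen → S)
  (h₁ : f (Gen.q 0) * f Gen.qinv = 1) (h₂ : f Gen.qinv * f (Gen.q 0) = 1)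

theorem lift_q (j : ℕ) : lift f h₁ h₂ (q j) = f (Gen.q j) := by
  rw [q, lift_mk, FreeAlgebra.lift_ι_apply]

theorem lift_qinv : lift f h₁ h₂ qinv = f Gen.qinv := by
  rw [qinv, lift_mk, FreeAlgebra.lift_ι_apply]

variable (u : Sˣ) (j : ℕ → S)

theorem eval_q_zero : eval u j (q 0) = u := lift_q _ _ _ _

theorem eval_q_succ (i : ℕ) : eval u j (q (i + 1)) = j (i + 1) := lift_q _ _ _ _

theorem eval_qinv : eval u j qinv = (u⁻¹ : Sˣ) := lift_qinv _ _ _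

end Lift

/-! ### The derivations D and E, the grading, and their commutator -/

theorem D_zero : D 0 = 0 := by simp [D]

theorem D_one : D 1 = 0 := by simp [D]

theorem D_algebraMap (r : ℝ) : D (algebraMap ℝ DiffPoly r) = 0 := by
  rw [Algebra.algebraMap_eq_smul_one, D_smul, D_one, smul_zero]

theorem D_neg (F : DiffPoly) : D (-F) = -D F := by simp [D]

theorem D_sub (F G : DiffPoly) : D (F - G) = D F - D G := by simp [D]

/-- The values of the generators under `F ↦ F + ε E F`, with `E (∂ₓʲ Q) = j (j - 1) ∂ₓʲ⁻¹ Q` and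
`E (Q⁻¹) = 0`. -/
noncomputable def genLower : Gen → TrivSqZeroExt DiffPoly DiffPoly
  | Gen.q j => (q j, ((j : ℝ) * (j - 1)) • q (j - 1))
  | Gen.qinv => (qinv, 0)

/-- The homomorphism `F ↦ F + ε E F` to the algebra of dual numbers over `DiffPoly`. -/
noncomputable def lowerHom : DiffPoly →ₐ[ℝ] TrivSqZeroExt DiffPoly DiffPoly :=
  lift genLower
    (by
      refine TrivSqZeroExt.ext q_mul_qinv ?_
      change q 0 * 0 + (((0 : ℕ) : ℝ) * ((0 : ℕ) - 1)) • q (0 - 1) * qinv = 0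
      simp)
    (by
      refine TrivSqZeroExt.ext qinv_mul_q ?_
      change qinv * ((((0 : ℕ) : ℝ) * ((0 : ℕ) - 1)) • q (0 - 1)) + 0 * q 0 = 0
      simp)

/-- The derivation `E` of differential polynomials that lowers the number of derivatives, with
`E (∂ₓʲ Q) = j (j - 1) ∂ₓʲ⁻¹ Q` and `E (Q⁻¹) = 0`. -/
noncomputable def lower (F : DiffPoly) : DiffPoly := (lowerHom F).snd

theorem lowerHom_q (j : ℕ) :
    lowerHom (q j) = (q j, ((j : ℝ) * (j - 1)) • q (j - 1)) := lift_q _ _ _ _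

theorem lowerHom_qinv : lowerHom qinv = (qinv, 0) := lift_qinv _ _ _

theorem fst_lowerHom (F : DiffPoly) : (lowerHom F).fst = F := by
  have h : (TrivSqZeroExt.fstHom ℝ DiffPoly DiffPoly).comp lowerHom = AlgHom.id ℝ DiffPoly := by
    apply hom_ext
    · intro j
      rw [AlgHom.comp_apply, lowerHom_q]
      rfl
    · rw [AlgHom.comp_apply, lowerHom_qinv]
      rfl
  exact DFunLike.congr_fun h F

theorem lower_zero : lower 0 = 0 := by simp [lower]

theorem lower_add (F G : DiffPoly) : lower (F + G) = lower F + lower G := by simp [lower]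

theorem lower_smul (c : ℝ) (F : DiffPoly) : lower (c • F) = c • lower F := by simp [lower]

theorem lower_neg (F : DiffPoly) : lower (-F) = -lower F := by simp [lower]

theorem lower_mul (F G : DiffPoly) : lower (F * G) = lower F * G + F * lower G := by
  simp only [lower, map_mul, TrivSqZeroExt.snd_mul, fst_lowerHom]
  exact add_comm _ _

theorem lower_algebraMap (r : ℝ) : lower (algebraMap ℝ DiffPoly r) = 0 := by
  rw [lower, AlgHom.commutes]
  rfl

theorem lower_q (j : ℕ) : lower (q j) = ((j : ℝ) * (j - 1)) • q (j - 1) := by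
  rw [lower, lowerHom_q]
  rfl

theorem lower_qinv : lower qinv = 0 := by
  rw [lower, lowerHom_qinv]
  rfl

/-- The grading of `DiffPoly` by the number of derivatives, as the homomorphism
`∂ₓʲ Q ↦ ∂ₓʲ Q Xʲ`. -/
noncomputable def grade : DiffPoly →ₐ[ℝ] DiffPoly[X] :=
  lift (fun g => match g with
      | Gen.q j => Polynomial.C (q j) * X ^ j
      | Gen.qinv => Polynomial.C qinv)
    (by simp [← Polynomial.C_mul, q_mul_qinv]) (by simp [← Polynomial.C_mul, qinv_mul_q])

theorem grade_q (j : ℕ) : grade (q j) = Polynomial.C (q j) * X ^ j := lift_q _ _ _ _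

theorem grade_qinv : grade qinv = Polynomial.C qinv := lift_qinv _ _ _

/-- The coefficientwise action of an additive map on polynomials. -/
noncomputable def coeffMap (d : DiffPoly → DiffPoly) (p : DiffPoly[X]) : DiffPoly[X] :=
  p.sum fun n a => Polynomial.C (d a) * X ^ n

section coeffMap

variable {d : DiffPoly → DiffPoly}

theorem coeff_coeffMap (h0 : d 0 = 0) (p : DiffPoly[X]) (n : ℕ) :
    (coeffMap d p).coeff n = d (p.coeff n) := by
  rw [coeffMap, Polynomial.sum, finsetSum_coeff]
  simp only [coeff_C_mul_X_pow]
  rw [Finset.sum_ite_eq]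
  split_ifs with h
  · rfl
  · rw [notMem_support_iff.1 h, h0]

theorem coeffMap_add (h0 : d 0 = 0) (hd : ∀ F G, d (F + G) = d F + d G) (p r : DiffPoly[X]) :
    coeffMap d (p + r) = coeffMap d p + coeffMap d r := by
  ext n
  simp only [coeff_coeffMap h0, coeff_add, hd]

theorem coeffMap_mul (h0 : d 0 = 0) (hd : ∀ F G, d (F + G) = d F + d G)
    (hm : ∀ F G, d (F * G) = d F * G + F * d G) (p r : DiffPoly[X]) :
    coeffMap d (p * r) = coeffMap d p * r + p * coeffMap d r := by
  ext n
  have hs : ∀ (s : Finset (ℕ × ℕ)) (f : ℕ × ℕ → DiffPoly),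
      d (∑ x ∈ s, f x) = ∑ x ∈ s, d (f x) := fun s f =>
    map_sum (AddMonoidHom.mk' d hd) f s
  simp only [coeff_coeffMap h0, coeff_add, coeff_mul, hs, hm, Finset.sum_add_distrib]

theorem coeffMap_C_mul_X_pow (h0 : d 0 = 0) (F : DiffPoly) (j : ℕ) :
    coeffMap d (Polynomial.C F * X ^ j) = Polynomial.C (d F) * X ^ j := by
  ext n
  rw [coeff_coeffMap h0, coeff_C_mul_X_pow, coeff_C_mul_X_pow]
  split_ifs <;> simp [h0]

theorem coeffMap_C (h0 : d 0 = 0) (F : DiffPoly) : coeffMap d (Polynomial.C F) = Polynomial.C (d F) := by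
  simpa using coeffMap_C_mul_X_pow h0 F 0

end coeffMap

theorem grade_D (F : DiffPoly) : grade (D F) = X * coeffMap D (grade F) := by
  induction F using MetaMKdV.induction with
  | h_const r =>
    rw [D_algebraMap, AlgHom.commutes, Polynomial.algebraMap_apply, coeffMap_C D_zero,
      D_algebraMap]
    simp
  | h_q j =>
    rw [D_q, grade_q, grade_q, coeffMap_C_mul_X_pow D_zero, D_q, X_mul, mul_assoc, pow_succ]
  | h_qinv =>
    rw [grade_qinv, coeffMap_C D_zero, D_qinv, ← neg_one_smul ℝ, ← smul_C, map_smul, map_mul,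
      map_mul, grade_q, grade_qinv, mul_smul_comm, C_mul, C_mul, pow_one]
    simp only [X_mul, mul_assoc]
  | h_add F G hF hG => rw [D_add, map_add, map_add, coeffMap_add D_zero D_add, hF, hG, mul_add]
  | h_mul F G hF hG =>
    rw [D_mul, map_add, map_mul, map_mul, map_mul, coeffMap_mul D_zero D_add D_mul, hF, hG,
      mul_add, ← mul_assoc, ← mul_assoc, ← mul_assoc, X_mul (p := grade F)]

/-- E lowers the degree by one; the factor X stands on the left to avoid dividing by it. -/
theorem X_mul_grade_lower (F : DiffPoly) :
    X * grade (lower F) = coeffMap lower (grade F) := by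
  induction F using MetaMKdV.induction with
  | h_const r =>
    rw [lower_algebraMap, AlgHom.commutes, Polynomial.algebraMap_apply, coeffMap_C lower_zero,
      lower_algebraMap]
    simp
  | h_q j =>
    rw [lower_q, grade_q, coeffMap_C_mul_X_pow lower_zero, lower_q, map_smul, grade_q]
    cases j with
    | zero => simp
    | succ j =>
      rw [mul_smul_comm, X_mul, mul_assoc, Nat.add_sub_cancel, ← pow_succ, ← smul_C,
        smul_mul_assoc]
  | h_qinv =>
    rw [lower_qinv, grade_qinv, coeffMap_C lower_zero, lower_qinv]
    simp
  | h_add F G hF hG =>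
    rw [lower_add, map_add, map_add, coeffMap_add lower_zero lower_add, ← hF, ← hG, mul_add]
  | h_mul F G hF hG =>
    rw [lower_mul, map_add, map_mul, map_mul, map_mul,
      coeffMap_mul lower_zero lower_add lower_mul, ← hF, ← hG,
      mul_add, ← mul_assoc, ← mul_assoc, ← mul_assoc, X_mul (p := grade F)]

/-- The commutator `[E, D]`, the derivation with `∂ₓʲ Q ↦ 2 j ∂ₓʲ Q`. -/
noncomputable def weight (F : DiffPoly) : DiffPoly := lower (D F) - D (lower F)

theorem weight_zero : weight 0 = 0 := by simp [weight, D_zero, lower_zero]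

theorem weight_add (F G : DiffPoly) : weight (F + G) = weight F + weight G := by
  simp only [weight, D_add, lower_add]
  abel

theorem weight_mul (F G : DiffPoly) : weight (F * G) = weight F * G + F * weight G := by
  simp only [weight, D_mul, lower_mul, D_add, lower_add]
  noncomm_ring

/-- The factor j (j - 1) in E is chosen for this: (j + 1) j - j (j - 1) = 2 j. -/
theorem weight_q (j : ℕ) : weight (q j) = (2 * j : ℝ) • q j := by
  rw [weight, D_q, lower_q, lower_q, D_smul, D_q]
  cases j with
  | zero => simp
  | succ j =>
    rw [Nat.add_sub_cancel, Nat.add_sub_cancel, ← sub_smul]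
    congr 1
    push_cast
    ring

theorem weight_qinv : weight qinv = 0 := by
  simp [weight, D_qinv, lower_qinv, lower_neg, lower_mul, lower_q, D_zero]

theorem coeffMap_weight_grade (F : DiffPoly) :
    coeffMap weight (grade F) = (2 : ℝ) • (X * derivative (grade F)) := by
  induction F using MetaMKdV.induction with
  | h_const r =>
    rw [AlgHom.commutes, Polynomial.algebraMap_apply, coeffMap_C weight_zero, weight,
      D_algebraMap, lower_algebraMap, lower_zero, D_zero]
    simp
  | h_q j =>
    rw [grade_q, coeffMap_C_mul_X_pow weight_zero, weight_q]
    cases j with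
    | zero => simp
    | succ j =>
      rw [derivative_C_mul_X_pow, Nat.add_sub_cancel, X_mul, mul_assoc, ← pow_succ,
        ← smul_mul_assoc, smul_C]
      congr 2
      rw [← nsmul_eq_mul' (q (j + 1)), ← Nat.cast_smul_eq_nsmul ℝ, smul_smul]
  | h_qinv =>
    rw [grade_qinv, coeffMap_C weight_zero, weight_qinv]
    simp
  | h_add F G hF hG =>
    rw [map_add, coeffMap_add weight_zero weight_add, hF, hG, derivative_add, mul_add, smul_add]
  | h_mul F G hF hG =>
    rw [map_mul, coeffMap_mul weight_zero weight_add weight_mul, hF, hG, derivative_mul, mul_add,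
      smul_add, smul_mul_assoc, mul_smul_comm, mul_assoc, ← mul_assoc (grade F), ← X_mul,
      mul_assoc]

theorem D_coeff_grade {F : DiffPoly} (h : D F = 0) (n : ℕ) : D ((grade F).coeff n) = 0 := by
  rw [← coeff_coeffMap D_zero, ← coeff_X_mul, ← grade_D, h, map_zero, coeff_zero]

theorem lower_coeff_grade_zero (F : DiffPoly) : lower ((grade F).coeff 0) = 0 := by
  rw [← coeff_coeffMap lower_zero, ← X_mul_grade_lower, coeff_X_mul_zero]

theorem lower_coeff_grade_succ (F : DiffPoly) (n : ℕ) :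
    lower ((grade F).coeff (n + 1)) = (grade (lower F)).coeff n := by
  rw [← coeff_coeffMap lower_zero, ← X_mul_grade_lower, coeff_X_mul]

theorem weight_coeff_grade (F : DiffPoly) (n : ℕ) :
    weight ((grade F).coeff n) = (2 * n : ℝ) • (grade F).coeff n := by
  rw [← coeff_coeffMap weight_zero, coeffMap_weight_grade, coeff_smul, mul_smul]
  congr 1
  cases n with
  | zero => simp
  | succ n =>
    rw [coeff_X_mul, coeff_derivative, ← Nat.cast_succ, ← nsmul_eq_mul', Nat.cast_smul_eq_nsmul]

theorem iterate_lower_coeff_grade (F : DiffPoly) {i n : ℕ} (h : i ≤ n) :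
    lower^[i] ((grade F).coeff n) = (grade (lower^[i] F)).coeff (n - i) := by
  induction i with
  | zero => rfl
  | succ i ih =>
    obtain ⟨m, rfl⟩ := Nat.exists_eq_add_of_le h
    rw [Function.iterate_succ_apply', ih (by omega), Function.iterate_succ_apply',
      ← lower_coeff_grade_succ]
    congr 3
    omega

theorem iterate_lower_coeff_grade_eq_zero (F : DiffPoly) (n : ℕ) :
    lower^[n + 1] ((grade F).coeff n) = 0 := by
  rw [Function.iterate_succ_apply', iterate_lower_coeff_grade F le_rfl, Nat.sub_self,
    lower_coeff_grade_zero]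

/-- Each E^m F_n has n - m derivatives, so moving D past E^{i+1} collects -(2n + 2(n - 1) + … + 2(n
- i)) = -(i + 1)(2n - i), and D F_n = 0 removes the rest. -/
theorem D_iterate_lower {F : DiffPoly} (h : D F = 0) {n i : ℕ} (hi : i ≤ n) :
    D (lower^[i + 1] ((grade F).coeff n)) =
      (-((i + 1) * (2 * n - i)) : ℝ) • lower^[i] ((grade F).coeff n) := by
  have key : ∀ i ≤ n, D (lower^[i + 1] ((grade F).coeff n)) =
      lower (D (lower^[i] ((grade F).coeff n))) -
        (2 * (n - i) : ℝ) • lower^[i] ((grade F).coeff n) := by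
    intro i hi
    have := weight_coeff_grade (lower^[i] F) (n - i)
    rw [← iterate_lower_coeff_grade F hi, weight, Nat.cast_sub hi] at this
    rw [Function.iterate_succ_apply', ← this]
    abel
  induction i with
  | zero =>
    rw [key 0 hi, Function.iterate_zero_apply, D_coeff_grade h, lower_zero, zero_sub, ← neg_smul]
    congr 1
    push_cast
    ring
  | succ i ih =>
    rw [key _ hi, ih (by omega), lower_smul, ← Function.iterate_succ_apply' lower, ← sub_smul]
    congr 1
    push_cast
    ring

theorem coeff_grade_eq_zero {F : DiffPoly} (h : D F = 0) {n : ℕ} (hn : n ≠ 0) :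
    (grade F).coeff n = 0 := by
  -- Descent from E^{n+1} F_n = 0 to F_n = 0: if E^{m+1} F_n = 0, then `D_iterate_lower` gives E^m
  -- F_n = 0, as (m + 1)(2n - m) ≠ 0 for m ≤ n and n ≥ 1.
  have key : ∀ i ≤ n + 1, lower^[n + 1 - i] ((grade F).coeff n) = 0 := by
    intro i
    induction i with
    | zero => exact fun _ => iterate_lower_coeff_grade_eq_zero F n
    | succ i ih =>
      intro hi
      have h1 := ih (by omega)
      have h2 := D_iterate_lower h (show n + 1 - (i + 1) ≤ n by omega)
      rw [show n + 1 - (i + 1) + 1 = n + 1 - i by omega, h1, D_zero, eq_comm,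
        smul_eq_zero] at h2
      refine h2.resolve_left ?_
      have h3 : ((n + 1 - (i + 1) : ℕ) : ℝ) ≤ n := by exact_mod_cast (by omega)
      have h4 : (0 : ℝ) < n := by exact_mod_cast Nat.pos_of_ne_zero hn
      have h5 : (0 : ℝ) ≤ ((n + 1 - (i + 1) : ℕ) : ℝ) := Nat.cast_nonneg _
      exact neg_ne_zero.2 (mul_ne_zero (by linarith) (by linarith))
  simpa using key (n + 1) le_rfl

/-- Substituting T ↦ Q in the derivative-free part recovers the degree-zero component. -/
theorem coeff_grade_zero {F : DiffPoly} (h : derivFreePart F = 0) : (grade F).coeff 0 = 0 := by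
  let u : DiffPolyˣ := ⟨q 0, qinv, q_mul_qinv, qinv_mul_q⟩
  let g : LaurentPolynomial ℝ →ₐ[ℝ] DiffPoly :=
    AddMonoidAlgebra.lift ℝ DiffPoly ℤ ((Units.coeHom DiffPoly).comp (zpowersHom _ u))
  have hT : ∀ n : ℤ, g (LaurentPolynomial.T n) = ((u ^ n : DiffPolyˣ) : DiffPoly) := fun n => by
    rw [LaurentPolynomial.T, AddMonoidAlgebra.lift_single]
    simp
  have key : ∀ F, (grade F).coeff 0 = g (derivFreePart F) := by
    intro F
    induction F using MetaMKdV.induction with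
    | h_const r =>
      rw [AlgHom.commutes, AlgHom.commutes, AlgHom.commutes, Polynomial.algebraMap_apply,
        coeff_C_zero]
    | h_q j =>
      rw [grade_q]
      cases j with
      | zero =>
        rw [derivFreePart, eval_q_zero]
        change _ = g (LaurentPolynomial.T 1)
        rw [hT]
        simp [u]
      | succ j => simp [derivFreePart, eval_q_succ]
    | h_qinv =>
      rw [grade_qinv, derivFreePart, eval_qinv]
      change _ = g (LaurentPolynomial.T (-1))
      rw [hT]
      simp [u]
    | h_add F G hF hG => rw [map_add, coeff_add, hF, hG, map_add, map_add]
    | h_mul F G hF hG => rw [map_mul, mul_coeff_zero, hF, hG, map_mul, map_mul]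
  rw [key, h, map_zero]

/-- Setting X = 1 sums the homogeneous components; it is multiplicative over noncommuting
coefficients because 1 is central. -/
theorem eval_one_grade (F : DiffPoly) : (grade F).eval 1 = F := by
  induction F using MetaMKdV.induction with
  | h_const r => simp [Polynomial.algebraMap_apply]
  | h_q j => simp [grade_q]
  | h_qinv => simp [grade_qinv]
  | h_add F G hF hG => rw [map_add, Polynomial.eval_add, hF, hG]
  | h_mul F G hF hG =>
    rw [map_mul, Polynomial.eval, eval₂_mul_noncomm _ _ fun _ => Commute.one_right _]
    exact congrArg₂ _ hF hG

/-- There are no constants of integration. -/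
theorem eq_zero_of_D_eq_zero {F : DiffPoly} (h : D F = 0) (h' : derivFreePart F = 0) : F = 0 := by
  rw [← eval_one_grade F, show grade F = 0 from ?_, eval_zero]
  ext n
  rcases eq_or_ne n 0 with rfl | hn
  · exact coeff_grade_zero h'
  · exact coeff_grade_eq_zero h hn

/-! ### Uniqueness of antiderivatives and of Φ(Q)K -/

theorem IsAntideriv.unique {G F F' : DiffPoly} (h : IsAntideriv G F) (h' : IsAntideriv G F') :
    F = F' := by
  rw [← sub_eq_zero]
  exact eq_zero_of_D_eq_zero (by rw [D_sub, h.1, h'.1, sub_self])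
    (by rw [map_sub, h.2, h'.2, sub_self])

theorem IsPhi.unique {K K₁ K₂ : DiffPoly} (h₁ : IsPhi K K₁) (h₂ : IsPhi K K₂) : K₁ = K₂ := by
  obtain ⟨W, F, X, G, rfl, hF, rfl, hG, rfl⟩ := h₁
  obtain ⟨W, F', X, G', rfl, hF', rfl, hG', rfl⟩ := h₂
  obtain rfl := hF.unique hF'
  rw [hG.unique hG']

end MetaMKdV

namespace MetaMKdV

open Finset

/-! ### Existence of the hierarchy -/

section Recursion

variable {B : Type*} [Ring B] {s : B}

/-- For x = ∇P_k and y = ∑ P_i P_j this computes both s P_{k+1} and P_{k+1} s, hence separates the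
commutator from the anticommutator. -/
theorem mul_sub_mul_of_anticommute (hs : s * s = 1) {x y : B} (hx : s * x = -(x * s))
    (hy : s * y = y * s) : s * (s * (x - y)) = x - y ∧ s * (x - y) * s = -x - y := by
  refine ⟨by rw [← mul_assoc, hs, one_mul], ?_⟩
  rw [mul_sub, hx, hy, sub_mul, neg_mul, mul_assoc, mul_assoc, hs, mul_one, mul_one]

theorem eq_zero_of_commute_of_anticommute [Module ℝ B] (hs : s * s = 1) {x : B} (h : s * x = x * s)
    (h' : s * x = -(x * s)) : x = 0 := by
  have h0 : x * s = 0 := by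
    have h2 : (2 : ℝ) • (x * s) = 0 := by
      rw [two_smul]
      nth_rw 1 [← h]
      rw [h', neg_add_cancel]
    exact (smul_eq_zero.1 h2).resolve_left two_ne_zero
  rw [← mul_one x, ← hs, ← mul_assoc, h0, zero_mul]

/-- If `s² = 1`, the derivation `∇` satisfies `∇ s = s P₀ - P₀ s`, and
`P (k + 1) = s (∇ P k - ∑ i + j = k, P i P j)`, then `s` anticommutes with all `∇ P k` and commutes
with all the sums, if `s` anticommutes with `P 0` and `∇ P 0`. -/
theorem anticommute_and_commute [Module ℝ B] (hs : s * s = 1) (nabla : B →+ B)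
    (h_mul : ∀ x y, nabla (x * y) = nabla x * y + x * nabla y) {P : ℕ → B}
    (h_s : nabla s = s * P 0 - P 0 * s) (h₀ : s * P 0 = -(P 0 * s))
    (h_nabla : s * nabla (P 0) = -(nabla (P 0) * s))
    (hP : ∀ k, P (k + 1) = s * (nabla (P k) - ∑ x ∈ antidiagonal k, P x.1 * P x.2)) (k : ℕ) :
    s * nabla (P k) = -(nabla (P k) * s) ∧
      s * (∑ x ∈ antidiagonal k, P x.1 * P x.2) =
        (∑ x ∈ antidiagonal k, P x.1 * P x.2) * s := by
  induction k using Nat.strong_induction_on with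
  | _ k ih =>
    cases k with
    | zero =>
      refine ⟨h_nabla, ?_⟩
      rw [HasAntidiagonal.antidiagonal_zero, sum_singleton, ← mul_assoc, h₀, neg_mul, mul_assoc, h₀,
        mul_neg, neg_neg, mul_assoc]
    | succ k =>
      set S : ℕ → B := fun k => ∑ x ∈ antidiagonal k, P x.1 * P x.2 with hS
      have h_left : ∀ j ≤ k, s * P (j + 1) = nabla (P j) - S j := fun j hj => by
        rw [hP]
        exact (mul_sub_mul_of_anticommute hs (ih j (by omega)).1 (ih j (by omega)).2).1
      have h_right : ∀ j ≤ k, P (j + 1) * s = -nabla (P j) - S j := fun j hj => by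
        rw [hP]
        exact (mul_sub_mul_of_anticommute hs (ih j (by omega)).1 (ih j (by omega)).2).2
      have h_sub : ∀ j ≤ k, s * P (j + 1) - P (j + 1) * s = nabla (P j) + nabla (P j) :=
        fun j hj => by
          rw [h_left j hj, h_right j hj]
          abel
      have h_add : s * P (k + 1) + P (k + 1) * s = -(S k + S k) := by
        rw [h_left k le_rfl, h_right k le_rfl]
        abel
      -- [s, ·] is a derivation: the end terms with `P 0` produce `nabla s`, and the others, by
      -- `h_sub`, twice the derivative of `S k`.
      have h_comm : s * S (k + 1) - S (k + 1) * s =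
          (nabla s * P (k + 1) + P (k + 1) * nabla s) + (nabla (S k) + nabla (S k)) := by
        have e1 : s * S (k + 1) - S (k + 1) * s =
            ∑ x ∈ antidiagonal (k + 1), (s * P x.1 - P x.1 * s) * P x.2 +
            ∑ x ∈ antidiagonal (k + 1), P x.1 * (s * P x.2 - P x.2 * s) := by
          rw [hS, mul_sum, sum_mul, ← sum_sub_distrib, ← sum_add_distrib]
          exact sum_congr rfl fun x _ => by noncomm_ring
        have e2 : ∑ x ∈ antidiagonal k, (s * P (x.1 + 1) - P (x.1 + 1) * s) * P x.2 =
            ∑ x ∈ antidiagonal k, (nabla (P x.1) * P x.2 + nabla (P x.1) * P x.2) :=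
          sum_congr rfl fun x hx => by
            rw [h_sub _ (by rw [HasAntidiagonal.mem_antidiagonal] at hx; omega), add_mul]
        have e3 : ∑ x ∈ antidiagonal k, P x.1 * (s * P (x.2 + 1) - P (x.2 + 1) * s) =
            ∑ x ∈ antidiagonal k, (P x.1 * nabla (P x.2) + P x.1 * nabla (P x.2)) :=
          sum_congr rfl fun x hx => by
            rw [h_sub _ (by rw [HasAntidiagonal.mem_antidiagonal] at hx; omega), mul_add]
        rw [e1, Nat.sum_antidiagonal_succ, Nat.sum_antidiagonal_succ', e2, e3, ← h_s, hS, map_sum]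
        simp only [h_mul, sum_add_distrib]
        abel
      have h_key : s * S (k + 1) - S (k + 1) * s =
          -(s * nabla (P (k + 1)) + nabla (P (k + 1)) * s) := by
        have := congrArg nabla h_add
        rw [map_add, h_mul, h_mul, map_neg, map_add] at this
        rw [h_comm, ← neg_eq_iff_eq_neg.2 this]
        abel
      -- As an anticommutator with `s` it commutes with `s`; by `h_key` it is also minus a
      -- commutator with `s`, so it anticommutes with `s`.
      have hY0 : s * nabla (P (k + 1)) + nabla (P (k + 1)) * s = 0 := by
        apply eq_zero_of_commute_of_anticommute hs
        · rw [mul_add, add_mul, ← mul_assoc, hs, mul_assoc _ s s, hs, mul_assoc, one_mul, mul_one]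
          abel
        · rw [← neg_eq_iff_eq_neg.2 h_key, mul_neg, neg_mul, neg_neg, mul_sub, sub_mul, ← mul_assoc,
            hs, mul_assoc _ s s, hs, mul_assoc, one_mul, mul_one]
          abel
      rw [hY0, neg_zero, sub_eq_zero] at h_key
      exact ⟨eq_neg_of_add_eq_zero_left hY0, h_key⟩

end Recursion

/-! ### The resolvent of the linear system -/

open Matrix

/-- The matrix that exchanges the two coordinates. -/
def swap (R : Type*) [Zero R] [One R] : Matrix (Fin 2) (Fin 2) R := !![0, 1; 1, 0]

theorem swap_mul_swap (R : Type*) [NonAssocSemiring R] : swap R * swap R = 1 := by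
  simp [swap, Matrix.one_fin_two]

/-- The coefficients `P k` of the resolvent `σ + 2 ∑ P k z⁻ᵏ⁻¹` of the linear system
`ψ_x = (z σ / 2 + diag (V, -V)) ψ`. -/
noncomputable def resolvent : ℕ → Matrix (Fin 2) (Fin 2) DiffPoly
  | 0 => !![V, 0; 0, -V]
  | k + 1 => swap DiffPoly * ((resolvent k).map D - (!![V, 0; 0, -V] * resolvent k -
      resolvent k * !![V, 0; 0, -V]) -
        ∑ x ∈ (antidiagonal k).attach,
          have := HasAntidiagonal.mem_antidiagonal.1 x.2
          resolvent x.1.1 * resolvent x.1.2)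
  decreasing_by all_goals (simp only [Nat.succ_eq_add_one]; omega)

theorem resolvent_zero : resolvent 0 = !![V, 0; 0, -V] := by rw [resolvent]

theorem resolvent_succ (k : ℕ) :
    resolvent (k + 1) = swap DiffPoly * ((resolvent k).map D -
      (resolvent 0 * resolvent k - resolvent k * resolvent 0) -
        ∑ x ∈ antidiagonal k, resolvent x.1 * resolvent x.2) := by
  conv_lhs => rw [resolvent]
  rw [resolvent_zero,
    Finset.sum_attach (antidiagonal k) fun x => resolvent x.1 * resolvent x.2]

/-- The covariant derivative `X ↦ D X - [diag (V, -V), X]`. -/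
noncomputable def nabla :
    Matrix (Fin 2) (Fin 2) DiffPoly →+ Matrix (Fin 2) (Fin 2) DiffPoly where
  toFun X := X.map D - (resolvent 0 * X - X * resolvent 0)
  map_zero' := by
    ext i j
    simp [D_zero]
  map_add' X Y := by
    rw [Matrix.map_add D D_add]
    noncomm_ring

theorem nabla_apply (X : Matrix (Fin 2) (Fin 2) DiffPoly) :
    nabla X = X.map D - (resolvent 0 * X - X * resolvent 0) := rfl

theorem D_sum {ι : Type*} (s : Finset ι) (f : ι → DiffPoly) :
    D (∑ i ∈ s, f i) = ∑ i ∈ s, D (f i) :=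
  map_sum (AddMonoidHom.mk' D D_add) f s

theorem map_D_mul (X Y : Matrix (Fin 2) (Fin 2) DiffPoly) :
    (X * Y).map D = X.map D * Y + X * Y.map D := by
  ext i j
  simp only [Matrix.map_apply, Matrix.add_apply, Matrix.mul_apply, D_sum, D_mul, sum_add_distrib]

theorem nabla_mul (X Y : Matrix (Fin 2) (Fin 2) DiffPoly) :
    nabla (X * Y) = nabla X * Y + X * nabla Y := by
  simp only [nabla_apply, map_D_mul]
  noncomm_ring

theorem map_D_swap : (swap DiffPoly).map D = 0 := by
  ext i j
  fin_cases i <;> fin_cases j <;> simp [swap, D_zero, D_one]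

theorem resolvent_anticommute_and_commute (k : ℕ) :
    swap DiffPoly * nabla (resolvent k) = -(nabla (resolvent k) * swap DiffPoly) ∧
      swap DiffPoly * (∑ x ∈ antidiagonal k, resolvent x.1 * resolvent x.2) =
        (∑ x ∈ antidiagonal k, resolvent x.1 * resolvent x.2) * swap DiffPoly := by
  refine anticommute_and_commute (swap_mul_swap _) nabla nabla_mul ?_ ?_ ?_ resolvent_succ k
  · rw [nabla_apply, map_D_swap]
    abel
  · simp [resolvent_zero, swap, Matrix.neg_of]
  · ext i j
    fin_cases i <;> fin_cases j <;>
      simp [nabla_apply, resolvent_zero, swap, D_neg, D_zero, Matrix.mul_apply, Fin.sum_univ_two]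

/-- The commutator half of the resolvent equations, the only half whose entries enter Φ. -/
theorem swap_mul_resolvent_succ_sub (k : ℕ) :
    swap DiffPoly * resolvent (k + 1) - resolvent (k + 1) * swap DiffPoly =
      nabla (resolvent k) + nabla (resolvent k) := by
  obtain ⟨h₁, h₂⟩ := resolvent_anticommute_and_commute k
  obtain ⟨h₃, h₄⟩ := mul_sub_mul_of_anticommute (swap_mul_swap _) h₁ h₂
  rw [nabla_apply] at h₃ h₄ ⊢
  rw [resolvent_succ, h₃, h₄]
  abel

/-! ### Absence of integration constants, and the hierarchy -/

theorem derivFreePart_D (F : DiffPoly) : derivFreePart (D F) = 0 := by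
  induction F using MetaMKdV.induction with
  | h_const r => rw [D_algebraMap, map_zero]
  | h_q j => rw [D_q, derivFreePart, eval_q_succ, Pi.zero_apply]
  | h_qinv =>
    rw [D_qinv, derivFreePart, map_neg, map_mul, map_mul, eval_q_succ]
    simp
  | h_add F G hF hG => rw [D_add, map_add, hF, hG, add_zero]
  | h_mul F G hF hG => rw [D_mul, map_add, map_mul, map_mul, hF, hG]; simp

theorem derivFreePart_V : derivFreePart V = 0 := by
  rw [V, map_mul, derivFreePart, eval_q_succ]
  simp

/-- Every term of the recursion is a D-derivative or contains an earlier coefficient. Hence the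
entries qualify as values of D⁻¹. -/
theorem derivFreePart_resolvent (k : ℕ) : derivFreePart.mapMatrix (resolvent k) = 0 := by
  induction k using Nat.strong_induction_on with
  | _ k ih =>
    cases k with
    | zero =>
      ext i j
      fin_cases i <;> fin_cases j <;> simp [resolvent_zero, derivFreePart_V]
    | succ k =>
      have h : derivFreePart.mapMatrix ((resolvent k).map D) = 0 := by
        ext i j
        simp [derivFreePart_D]
      rw [resolvent_succ, map_mul, map_sub, map_sub, map_sub, map_mul, map_mul, h,
        ih k (by omega), map_sum, sum_eq_zero]
      · simp
      · intro x hx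
        rw [map_mul, ih x.1 (by rw [HasAntidiagonal.mem_antidiagonal] at hx; omega), zero_mul]

theorem derivFreePart_resolvent_apply (k : ℕ) (i j : Fin 2) :
    derivFreePart (resolvent k i j) = 0 :=
  congrFun (congrFun (derivFreePart_resolvent k) i) j

theorem resolvent_entries (k : ℕ) :
    (resolvent (k + 1) 1 0 - resolvent (k + 1) 0 1 =
      (2 : ℝ) • (D (resolvent k 0 0) - C (resolvent k 0 0))) ∧
    (resolvent (k + 1) 0 1 - resolvent (k + 1) 1 0 =
      (2 : ℝ) • (D (resolvent k 1 1) + C (resolvent k 1 1))) ∧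
    (resolvent (k + 1) 1 1 - resolvent (k + 1) 0 0 =
      (2 : ℝ) • (D (resolvent k 0 1) - AC (resolvent k 0 1))) ∧
    (resolvent (k + 1) 0 0 - resolvent (k + 1) 1 1 =
      (2 : ℝ) • (D (resolvent k 1 0) + AC (resolvent k 1 0))) := by
  have h := fun i j => congrFun (congrFun (swap_mul_resolvent_succ_sub k) i) j
  have h00 := h 0 0
  have h01 := h 0 1
  have h10 := h 1 0
  have h11 := h 1 1
  simp only [nabla_apply, swap, Matrix.sub_apply, Matrix.add_apply, Matrix.mul_apply,
    resolvent_zero, Fin.sum_univ_two, Matrix.of_apply, Matrix.map_apply, Matrix.cons_val_zero,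
    Matrix.cons_val_one, zero_mul, one_mul, mul_zero, mul_one, zero_add, add_zero]
    at h00 h01 h10 h11
  simp only [two_smul, C, AC]
  refine ⟨h00.trans ?_, h11.trans ?_, h01.trans ?_, h10.trans ?_⟩ <;> noncomm_ring

theorem isPhi_resolvent (k : ℕ) :
    IsPhi (resolvent k 0 0 * q 0) (resolvent (k + 2) 0 0 * q 0) := by
  obtain ⟨h₁, -⟩ := resolvent_entries k
  obtain ⟨-, -, h₂, h₃⟩ := resolvent_entries (k + 1)
  obtain ⟨h₄, h₅, -⟩ := resolvent_entries (k + 2)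
  have h₀ : resolvent k 0 0 * q 0 * qinv = resolvent k 0 0 := by
    rw [mul_assoc, q_mul_qinv, mul_one]
  -- The witnesses come from the next two coefficients. `resolvent_entries` gives each diagonal or
  -- off-diagonal difference twice, up to sign; equating the two expressions yields the equations
  -- for D F and D G.
  refine ⟨(1 / 2 : ℝ) • (resolvent (k + 1) 1 0 - resolvent (k + 1) 0 1),
    (-1 / 2 : ℝ) • (resolvent (k + 1) 0 1 + resolvent (k + 1) 1 0),
    (1 / 2 : ℝ) • (resolvent (k + 2) 0 0 - resolvent (k + 2) 1 1),
    resolvent (k + 2) 0 0, ?_, ⟨?_, ?_⟩, ?_, ⟨?_, derivFreePart_resolvent_apply _ _ _⟩, rfl⟩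
  · rw [h₀, h₁]
    module
  · simp only [D_smul, D_add, AC, mul_smul_comm, smul_mul_assoc, mul_sub, sub_mul] at h₂ h₃ ⊢
    linear_combination (norm := module) (1 / 4 : ℝ) • (h₂ + h₃)
  · simp [derivFreePart_resolvent_apply]
  · simp only [D_smul, D_sub, AC, mul_smul_comm, smul_mul_assoc, mul_add, add_mul] at h₂ h₃ ⊢
    linear_combination (norm := module) (1 / 4 : ℝ) • (h₃ - h₂)
  · simp only [D_smul, D_sub, C, mul_smul_comm, smul_mul_assoc, mul_sub, sub_mul] at h₄ h₅ ⊢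
    linear_combination (norm := module) (-1 / 4 : ℝ) • (h₄ + h₅)

theorem isHierarchy_resolvent : IsHierarchy fun n => resolvent (2 * n) 0 0 * q 0 := by
  refine ⟨?_, fun n => isPhi_resolvent (2 * n)⟩
  simp [resolvent_zero, V, mul_assoc, qinv_mul_q]

theorem IsHierarchy.unique {K K' : ℕ → DiffPoly} (h : IsHierarchy K) (h' : IsHierarchy K') :
    K = K' := by
  funext n
  induction n with
  | zero => rw [h.1, h'.1]
  | succ n ih => exact (h.2 n).unique (ih ▸ h'.2 n)

end MetaMKdV

namespace MetaMKdV

open Finset Matrix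

/-! ### Algebra of the explicit resolvent -/

section Dressing

variable {B : Type*} [Ring B] {s H a R : B}

theorem sum_antidiagonal_telescope {M : Type*} [AddCommGroup M] (f : ℕ → ℕ → M) (k : ℕ) :
    ∑ x ∈ antidiagonal k, (f (x.1 + 1) x.2 - f x.1 (x.2 + 1)) = f (k + 1) 0 - f 0 (k + 1) := by
  have h := (Nat.sum_antidiagonal_succ (n := k) (f := fun x => f x.1 x.2)).symm.trans
    (Nat.sum_antidiagonal_succ' (n := k) (f := fun x => f x.1 x.2))
  rw [sum_sub_distrib, sub_eq_sub_iff_add_eq_add, add_comm, h, add_comm]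

/-- The resolvent that is obtained from the trivial one, `s`, by dressing with `R = a⁻¹`, where `H`
is the spectral parameter. -/
def dressed (s H a R : B) (k : ℕ) : B := R * H ^ k * s * (H - R * H * a)

/-- The first two summands are the derivative of the k-th coefficient, as in
`hasMatrixLineDerivAt_dressed`. Since (H - R H a) R = [H, R], a product of two coefficients is a
difference that telescopes over the antidiagonal. -/
theorem dressed_succ (hs : s * s = 1) (hH : s * H = H * s) (hR : R * a = 1) (ha : a * R = 1)
    (hsa : s * a * s = 2 - a) (k : ℕ) :
    s * (R * H * s * (R - 1) * (H ^ k * s) * (H - R * H * a) +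
        R * H ^ k * s * (R * H * s * (H - R * H * a)) -
      (dressed s H a R 0 * dressed s H a R k - dressed s H a R k * dressed s H a R 0) -
      ∑ x ∈ antidiagonal k, dressed s H a R x.1 * dressed s H a R x.2) =
    dressed s H a R (k + 1) := by
  set c := H - R * H * a with hc
  set T := s * R * s with hT
  have hcR : c * R = H * R - R * H := by rw [hc, sub_mul, mul_assoc _ a, ha, mul_one]
  have hHs : ∀ j, H ^ j * s = s * H ^ j := fun j =>
    ((show Commute H s from hH.symm).pow_left j).eq
  have hprod : ∀ i j, dressed s H a R i * dressed s H a R j =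
      R * (H ^ (i + 1) * T * H ^ j - H ^ i * T * H ^ (j + 1)) * c := by
    intro i j
    have e : s * (c * R) * H ^ j * s = (H * T - T * H) * H ^ j := by
      have h₁ : s * (H * R) * s = H * T := by
        rw [← mul_assoc, hH, hT]
        simp only [mul_assoc]
      have h₂ : s * (R * H) * s = T * H := by
        rw [hT, mul_assoc s, mul_assoc R, ← hH]
        simp only [mul_assoc]
      rw [hcR, mul_assoc, hHs, ← mul_assoc, mul_sub, sub_mul, h₁, h₂]
    calc dressed s H a R i * dressed s H a R j
        = R * H ^ i * (s * (c * R) * H ^ j * s) * c := by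
          simp only [dressed, hc, mul_assoc]
      _ = _ := by
          rw [e, pow_succ, pow_succ']
          noncomm_ring
  -- Partial fractions: T inverts s a s = 2 - a, and a + (2 - a) = 2.
  have hRT : R + T = R * T + R * T := by
    have h1 : s * a * s * T = 1 := by
      rw [hT]
      simp only [mul_assoc]
      rw [← mul_assoc s s, hs, one_mul, ← mul_assoc a, ha, one_mul, hs]
    have h2 : R * (s * a * s) * T = R := by rw [mul_assoc, h1, mul_one]
    have h3 : R * a * T = T := by rw [hR, one_mul]
    rw [hsa] at h2
    nth_rw 1 [← h2]
    nth_rw 2 [← h3]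
    noncomm_ring
  have hT' : R * T + R * T - R = T := by rw [← hRT, add_sub_cancel_left]
  have e1 : R * H * s * (R - 1) * (H ^ k * s) = R * H * T * H ^ k - R * H ^ (k + 1) := by
    have h₁ : R * H * s * (R - 1) * s = R * H * T - R * H := by
      rw [mul_sub, mul_one, sub_mul, mul_assoc _ s s, hs, mul_one, hT]
      simp only [mul_assoc]
    rw [hHs, ← mul_assoc, h₁, sub_mul, pow_succ', mul_assoc R H (H ^ k)]
  have e2 : R * H ^ k * s * (R * H * s * c) = R * (H ^ k * T * H) * c := by
    have : s * (R * H * s) = T * H := by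
      rw [mul_assoc R, ← hH, ← mul_assoc, ← mul_assoc, ← hT]
    rw [mul_assoc _ s, ← mul_assoc s, this]
    simp only [mul_assoc]
  rw [sum_congr rfl fun x _ => hprod x.1 x.2, ← sum_mul, ← mul_sum,
    sum_antidiagonal_telescope (fun i j => H ^ i * T * H ^ j), hprod, hprod, e1, e2]
  have e3 : (R * H * T * H ^ k - R * H ^ (k + 1)) * c + R * (H ^ k * T * H) * c -
      (R * (H ^ (0 + 1) * T * H ^ k - H ^ 0 * T * H ^ (k + 1)) * c -
        R * (H ^ (k + 1) * T * H ^ 0 - H ^ k * T * H ^ (0 + 1)) * c) -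
      R * (H ^ (k + 1) * T * H ^ 0 - H ^ 0 * T * H ^ (k + 1)) * c =
      (R * T + R * T - R) * H ^ (k + 1) * c := by
    simp only [zero_add, pow_one, pow_zero, one_mul, mul_one, sub_mul, mul_sub, add_mul, mul_assoc]
    abel
  rw [e3, hT', dressed, ← hc, ← mul_assoc, ← mul_assoc, hT, ← mul_assoc, ← mul_assoc, hs, one_mul,
    mul_assoc R s, ← hHs, ← mul_assoc]

/-- The left side is the derivative of H - R H a by the product rule; the leading 0 comes from the
constant H. -/
theorem dressing_deriv (hH : s * H = H * s) :
    0 - (R * H * s * (R - 1) * H * a + R * H * (H * s * (a - 1))) =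
      R * H * s * (H - R * H * a) := by
  have : R * H * (H * s) = R * H * s * H := by rw [← hH, ← mul_assoc]
  rw [mul_sub (H * s), mul_sub (R * H), mul_one, this, ← mul_assoc (R * H), this]
  noncomm_ring

end Dressing

/-! ### Line derivatives -/

section LineDeriv

variable {E : Type*} [NormedAddCommGroup E] [NormedSpace ℝ E]
  {𝒜 : Type*} [NormedRing 𝒜] [NormedAlgebra ℝ 𝒜] {x v : E}

theorem hasLineDerivAt_const (a : 𝒜) : HasLineDerivAt ℝ (fun _ : E => a) 0 x v :=
  hasDerivAt_const _ _

theorem hasLineDerivAt_mul {f g : E → 𝒜} {f' g' : 𝒜} (hf : HasLineDerivAt ℝ f f' x v)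
    (hg : HasLineDerivAt ℝ g g' x v) :
    HasLineDerivAt ℝ (fun y => f y * g y) (f' * g x + f x * g') x v := by
  have := HasDerivAt.mul hf hg
  simp only [zero_smul, add_zero] at this
  exact this

theorem hasLineDerivAt_add {f g : E → 𝒜} {f' g' : 𝒜} (hf : HasLineDerivAt ℝ f f' x v)
    (hg : HasLineDerivAt ℝ g g' x v) : HasLineDerivAt ℝ (fun y => f y + g y) (f' + g') x v :=
  HasDerivAt.add hf hg

theorem hasLineDerivAt_sub {f g : E → 𝒜} {f' g' : 𝒜} (hf : HasLineDerivAt ℝ f f' x v)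
    (hg : HasLineDerivAt ℝ g g' x v) : HasLineDerivAt ℝ (fun y => f y - g y) (f' - g') x v :=
  HasDerivAt.sub hf hg

theorem hasLineDerivAt_ringInverse [CompleteSpace 𝒜] {f : E → 𝒜} {f' : 𝒜}
    (hf : HasLineDerivAt ℝ f f' x v) (hu : IsUnit (f x)) :
    HasLineDerivAt ℝ (fun y => Ring.inverse (f y))
      (-(Ring.inverse (f x) * f' * Ring.inverse (f x))) x v := by
  obtain ⟨u, hu⟩ := hu
  have h := hasFDerivAt_ringInverse (𝕜 := ℝ) u
  rw [show (u : 𝒜) = f (x + (0 : ℝ) • v) by rw [hu, zero_smul, add_zero]] at h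
  have h2 := h.comp_hasDerivAt (0 : ℝ) hf
  rw [← hu, Ring.inverse_unit]
  simpa using! h2

/-- The entries of `M` have at `x` in the direction `v` the derivatives `M'`. -/
def HasMatrixLineDerivAt (M : E → Matrix (Fin 2) (Fin 2) 𝒜) (M' : Matrix (Fin 2) (Fin 2) 𝒜)
    (x v : E) : Prop :=
  ∀ i j, HasLineDerivAt ℝ (fun y => M y i j) (M' i j) x v

theorem hasMatrixLineDerivAt_const (M : Matrix (Fin 2) (Fin 2) 𝒜) :
    HasMatrixLineDerivAt (fun _ : E => M) 0 x v :=
  fun _ _ => hasLineDerivAt_const _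

variable {M N : E → Matrix (Fin 2) (Fin 2) 𝒜} {M' N' : Matrix (Fin 2) (Fin 2) 𝒜}

theorem HasMatrixLineDerivAt.mul (hM : HasMatrixLineDerivAt M M' x v)
    (hN : HasMatrixLineDerivAt N N' x v) :
    HasMatrixLineDerivAt (fun y => M y * N y) (M' * N x + M x * N') x v := by
  intro i j
  have := hasLineDerivAt_add (hasLineDerivAt_mul (hM i 0) (hN 0 j))
    (hasLineDerivAt_mul (hM i 1) (hN 1 j))
  simp only [Matrix.add_apply, Matrix.mul_apply, Fin.sum_univ_two]
  convert this using 1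
  abel

theorem HasMatrixLineDerivAt.sub (hM : HasMatrixLineDerivAt M M' x v)
    (hN : HasMatrixLineDerivAt N N' x v) :
    HasMatrixLineDerivAt (fun y => M y - N y) (M' - N') x v :=
  fun i j => hasLineDerivAt_sub (hM i j) (hN i j)

theorem hasMatrixLineDerivAt_dressed {s H : Matrix (Fin 2) (Fin 2) 𝒜} (hH : s * H = H * s)
    {a R : E → Matrix (Fin 2) (Fin 2) 𝒜} (ha : HasMatrixLineDerivAt a (H * s * (a x - 1)) x v)
    (hR : HasMatrixLineDerivAt R (R x * H * s * (R x - 1)) x v) (k : ℕ) :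
    HasMatrixLineDerivAt (fun y => dressed s H (a y) (R y) k)
      (R x * H * s * (R x - 1) * (H ^ k * s) * (H - R x * H * a x) +
        R x * H ^ k * s * (R x * H * s * (H - R x * H * a x))) x v := by
  have hc := (hasMatrixLineDerivAt_const (x := x) (v := v) H).sub
    ((hR.mul (hasMatrixLineDerivAt_const H)).mul ha)
  rw [mul_zero, add_zero, dressing_deriv hH] at hc
  have := ((hR.mul (hasMatrixLineDerivAt_const (H ^ k))).mul (hasMatrixLineDerivAt_const s)).mul hc
  simpa only [dressed, mul_zero, add_zero, mul_assoc] using this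

end LineDeriv

/-! ### Partial derivatives and evaluation of differential polynomials -/

section Eval

variable {𝒜 : Type*} [NormedRing 𝒜] [NormedAlgebra ℝ 𝒜] {N : ℕ}

theorem hasLineDerivAt_pderiv {Ω : Set (Fin N → ℝ)} (hΩ : IsOpen Ω) {Q : (Fin N → ℝ) → 𝒜}
    (hQ : ContDiffOn ℝ ∞ Q Ω) {t : Fin N → ℝ} (ht : t ∈ Ω) (n : Fin N) :
    HasLineDerivAt ℝ Q (pderiv n Q t) t (Pi.single n 1) :=
  (((hQ.contDiffAt (hΩ.mem_nhds ht)).differentiableAt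
    (by simp)).lineDifferentiableAt).hasLineDerivAt

theorem contDiffOn_pderiv {Ω : Set (Fin N → ℝ)} (hΩ : IsOpen Ω) {Q : (Fin N → ℝ) → 𝒜}
    (hQ : ContDiffOn ℝ ∞ Q Ω) (n : Fin N) : ContDiffOn ℝ ∞ (pderiv n Q) Ω := by
  have h := (hQ.fderiv_of_isOpen hΩ (m := ∞) (by simp)).clm_apply
    (contDiffOn_const (c := (Pi.single n 1 : Fin N → ℝ)))
  refine h.congr fun t ht => ?_
  exact ((hQ.contDiffAt (hΩ.mem_nhds ht)).differentiableAt (by simp)).lineDeriv_eq_fderiv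

theorem contDiffOn_iterate_pderiv {Ω : Set (Fin N → ℝ)} (hΩ : IsOpen Ω) {Q : (Fin N → ℝ) → 𝒜}
    (hQ : ContDiffOn ℝ ∞ Q Ω) (n : Fin N) (j : ℕ) : ContDiffOn ℝ ∞ ((pderiv n)^[j] Q) Ω := by
  induction j with
  | zero => exact hQ
  | succ j ih =>
    rw [Function.iterate_succ_apply']
    exact contDiffOn_pderiv hΩ ih n

/-- Evaluation of differential polynomials intertwines `D` and the derivative. -/
theorem hasLineDerivAt_eval [CompleteSpace 𝒜] {Ω : Set (Fin N → ℝ)} (hΩ : IsOpen Ω)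
    {Q : (Fin N → ℝ) → 𝒜}
    (hQ : ContDiffOn ℝ ∞ Q Ω) {u : (Fin N → ℝ) → 𝒜ˣ} (hu : ∀ t ∈ Ω, (u t : 𝒜) = Q t) (n : Fin N)
    {t : Fin N → ℝ} (ht : t ∈ Ω) (F : DiffPoly) :
    HasLineDerivAt ℝ (fun y => eval (u y) (fun j => ((pderiv n)^[j] Q) y) F)
      (eval (u t) (fun j => ((pderiv n)^[j] Q) t) (D F)) t (Pi.single n 1) := by
  have hQt := hasLineDerivAt_pderiv hΩ hQ ht n
  have hΩt := hΩ.mem_nhds ht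
  induction F using MetaMKdV.induction with
  | h_const r =>
    simp only [D_algebraMap, map_zero, AlgHom.commutes]
    exact hasLineDerivAt_const _
  | h_q j =>
    rw [D_q]
    cases j with
    | zero =>
      simp only [eval_q_zero, eval_q_succ]
      exact hQt.congr_of_eventuallyEq (Filter.eventually_of_mem hΩt hu)
    | succ j =>
      simp only [eval_q_succ]
      rw [Function.iterate_succ_apply' _ (j + 1)]
      exact hasLineDerivAt_pderiv hΩ (contDiffOn_iterate_pderiv hΩ hQ n _) ht n
  | h_qinv =>
    rw [D_qinv]
    simp only [map_neg, map_mul, eval_qinv, eval_q_succ]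
    have h := hasLineDerivAt_ringInverse hQt (hu t ht ▸ (u t).isUnit)
    have h2 := h.congr_of_eventuallyEq (f₁ := fun y => ((u y)⁻¹ : 𝒜ˣ).val)
      (Filter.eventually_of_mem hΩt fun y hy => by
        simp only [← hu y hy, Ring.inverse_unit])
    rwa [← hu t ht, Ring.inverse_unit] at h2
  | h_add F G hF hG =>
    simp only [D_add, map_add]
    exact hasLineDerivAt_add hF hG
  | h_mul F G hF hG =>
    simp only [D_mul, map_add, map_mul]
    exact hasLineDerivAt_mul hF hG

end Eval

end MetaMKdV

namespace MetaMKdV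

open Finset Matrix

/-! ### The solutions -/

/-- Both sides obey the same recursion from the same start. The induction runs over all of Ω at
once, since its step differentiates the identity for `k` and so needs it near `t`. -/
theorem eval_resolvent {𝒜 : Type*} [NormedRing 𝒜] [NormedAlgebra ℝ 𝒜] [CompleteSpace 𝒜] {N : ℕ}
    {Ω : Set (Fin N → ℝ)} (hΩ : IsOpen Ω) {Q : (Fin N → ℝ) → 𝒜} (hQ : ContDiffOn ℝ ∞ Q Ω)
    {u : (Fin N → ℝ) → 𝒜ˣ} (hu : ∀ t ∈ Ω, (u t : 𝒜) = Q t) (n : Fin N)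
    {H : Matrix (Fin 2) (Fin 2) 𝒜} (hH : swap 𝒜 * H = H * swap 𝒜)
    {a R : (Fin N → ℝ) → Matrix (Fin 2) (Fin 2) 𝒜}
    (hRa : ∀ t ∈ Ω, R t * a t = 1) (haR : ∀ t ∈ Ω, a t * R t = 1)
    (hsa : ∀ t ∈ Ω, swap 𝒜 * a t * swap 𝒜 = 2 - a t)
    (ha' : ∀ t ∈ Ω, HasMatrixLineDerivAt a (H * swap 𝒜 * (a t - 1)) t (Pi.single n 1))
    (hR' : ∀ t ∈ Ω, HasMatrixLineDerivAt R (R t * H * swap 𝒜 * (R t - 1)) t (Pi.single n 1))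
    (h₀ : ∀ t ∈ Ω, (eval (u t) fun j => ((pderiv n)^[j] Q) t).mapMatrix (resolvent 0) =
      dressed (swap 𝒜) H (a t) (R t) 0) (k : ℕ) :
    ∀ t ∈ Ω, (eval (u t) fun j => ((pderiv n)^[j] Q) t).mapMatrix (resolvent k) =
      dressed (swap 𝒜) H (a t) (R t) k := by
  induction k using Nat.strong_induction_on with
  | _ k ih =>
    cases k with
    | zero => exact h₀
    | succ k =>
      intro t ht
      have hswap : (eval (u t) fun j => ((pderiv n)^[j] Q) t).mapMatrix (swap DiffPoly) =
          swap 𝒜 := by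
        ext i j
        fin_cases i <;> fin_cases j <;> simp [swap]
      have hD : (eval (u t) fun j => ((pderiv n)^[j] Q) t).mapMatrix ((resolvent k).map D) =
          R t * H * swap 𝒜 * (R t - 1) * (H ^ k * swap 𝒜) * (H - R t * H * a t) +
            R t * H ^ k * swap 𝒜 * (R t * H * swap 𝒜 * (H - R t * H * a t)) := by
        ext i j
        refine HasLineDerivAt.unique ?_
          (hasMatrixLineDerivAt_dressed hH (ha' t ht) (hR' t ht) k i j)
        exact (hasLineDerivAt_eval hΩ hQ hu n ht (resolvent k i j)).congr_of_eventuallyEq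
          (Filter.eventually_of_mem (hΩ.mem_nhds ht) fun y hy =>
            (congrFun (congrFun (ih k (by omega) y hy) i) j).symm)
      rw [resolvent_succ, map_mul, map_sub, map_sub, map_sub, map_mul, map_mul, map_sum, hswap, hD,
        ih k (by omega) t ht, h₀ t ht, ← dressed_succ (swap_mul_swap 𝒜) hH (hRa t ht) (haR t ht)
          (hsa t ht) k]
      congr 2
      refine sum_congr rfl fun x hx => ?_
      rw [HasAntidiagonal.mem_antidiagonal] at hx
      rw [map_mul, ih x.1 (by omega) t ht, ih x.2 (by omega) t ht]

/-! ### The soliton data and their derivatives -/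

section Soliton

variable {𝒜 : Type*} [NormedRing 𝒜] [NormedAlgebra ℝ 𝒜] [CompleteSpace 𝒜] {N : ℕ} (A : 𝒜ˣ)
  (B : 𝒜)

theorem contDiff_solitonL (A B : 𝒜) : ContDiff ℝ ∞ (solitonL A B : (Fin N → ℝ) → 𝒜) := by
  have h : ContDiff ℝ ∞ (NormedSpace.exp : 𝒜 → 𝒜) :=
    contDiff_iff_contDiffAt.2 fun x => (NormedSpace.exp_analytic (𝕂 := ℝ) x).contDiffAt
  refine ContDiff.mul (h.comp (ContDiff.sum fun k _ => ?_)) contDiff_const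
  exact (contDiff_apply ℝ ℝ k).smul contDiff_const

theorem hasLineDerivAt_solitonL (A B : 𝒜) (n : Fin N) (t : Fin N → ℝ) :
    HasLineDerivAt ℝ (solitonL A B) (A ^ (2 * (n : ℕ) + 1) * solitonL A B t) t
      (Pi.single n 1) := by
  let _ : NormedAlgebra ℚ 𝒜 := NormedAlgebra.restrictScalars ℚ ℝ 𝒜
  have h : ∀ x : ℝ, solitonL A B (t + x • Pi.single n 1) =
      NormedSpace.exp (x • A ^ (2 * (n : ℕ) + 1)) * solitonL A B t := by
    intro x
    rw [solitonL, solitonL, ← mul_assoc, ← NormedSpace.exp_add_of_commute]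
    · congr 2
      simp only [Pi.add_apply, add_smul, sum_add_distrib, Pi.smul_apply, Pi.single_apply,
        smul_eq_mul, mul_ite, mul_one, mul_zero, ite_smul, zero_smul]
      rw [sum_ite_eq', if_pos (mem_univ _), add_comm]
    · exact Commute.sum_right _ _ _ fun k _ =>
        (((Commute.refl A).pow_pow _ _).smul_left _).smul_right _
  have h2 := (hasDerivAt_exp_smul_const' (𝕂 := ℝ) (A ^ (2 * (n : ℕ) + 1)) 0).mul_const
    (solitonL A B t)
  rw [zero_smul, NormedSpace.exp_zero, mul_one] at h2
  rw [HasLineDerivAt]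
  simpa only [h] using h2

theorem isOpen_solitonDomain (A B : 𝒜) : IsOpen (solitonDomain A B N) :=
  (Units.isOpen.preimage (continuous_const.sub (contDiff_solitonL A B).continuous)).inter
    (Units.isOpen.preimage (continuous_const.add (contDiff_solitonL A B).continuous))

theorem contDiffOn_solitonQ :
    ContDiffOn ℝ ∞ (solitonQ A B) (solitonDomain (A : 𝒜) B N) := by
  intro t ht
  obtain ⟨u, hu⟩ := ht.1
  have hL := (contDiff_solitonL (N := N) (A : 𝒜) B).contDiffAt (x := t)
  have h1 : ContDiffAt ℝ ∞ (fun t => Ring.inverse (1 - solitonL (A : 𝒜) B t)) t := by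
    have := contDiffAt_ringInverse ℝ (n := ∞) u
    rw [hu] at this
    exact this.comp t (contDiffAt_const.sub hL)
  exact ((h1.mul contDiffAt_const).mul (contDiffAt_const.add hL)).contDiffWithinAt

/-- `(I - L)⁻¹` on the domain of the soliton. -/
noncomputable def invMinus (A B : 𝒜) (t : Fin N → ℝ) : 𝒜 := Ring.inverse (1 - solitonL A B t)

/-- `(I + L)⁻¹` on the domain of the soliton. -/
noncomputable def invPlus (A B : 𝒜) (t : Fin N → ℝ) : 𝒜 := Ring.inverse (1 + solitonL A B t)

section Inverses

variable {A B : 𝒜} {t : Fin N → ℝ}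

omit [CompleteSpace 𝒜]

theorem invMinus_mul (ht : t ∈ solitonDomain A B N) :
    invMinus A B t * (1 - solitonL A B t) = 1 := Ring.inverse_mul_cancel _ ht.1

theorem mul_invMinus (ht : t ∈ solitonDomain A B N) :
    (1 - solitonL A B t) * invMinus A B t = 1 := Ring.mul_inverse_cancel _ ht.1

theorem invPlus_mul (ht : t ∈ solitonDomain A B N) :
    invPlus A B t * (1 + solitonL A B t) = 1 := Ring.inverse_mul_cancel _ ht.2

theorem mul_invPlus (ht : t ∈ solitonDomain A B N) :
    (1 + solitonL A B t) * invPlus A B t = 1 := Ring.mul_inverse_cancel _ ht.2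

theorem invMinus_add_invPlus (ht : t ∈ solitonDomain A B N) :
    invMinus A B t + invPlus A B t = 2 * (invMinus A B t * invPlus A B t) := by
  have h₁ : invMinus A B t * ((1 + solitonL A B t) * invPlus A B t) = invMinus A B t := by
    rw [mul_invPlus ht, mul_one]
  have h₂ : invMinus A B t * (1 - solitonL A B t) * invPlus A B t = invPlus A B t := by
    rw [invMinus_mul ht, one_mul]
  nth_rw 1 [← h₁]
  nth_rw 2 [← h₂]
  noncomm_ring

theorem invMinus_mul_invPlus_comm :
    invMinus A B t * invPlus A B t = invPlus A B t * invMinus A B t := by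
  have h : Commute (1 - solitonL A B t) (1 + solitonL A B t) :=
    ((Commute.one_left _).sub_left ((Commute.one_right _).add_right (Commute.refl _)))
  exact h.ringInverse_ringInverse

end Inverses

theorem hasLineDerivAt_invMinus {A B : 𝒜} {t : Fin N → ℝ} (ht : t ∈ solitonDomain A B N)
    (n : Fin N) :
    HasLineDerivAt ℝ (invMinus A B) (invMinus A B t * A ^ (2 * (n : ℕ) + 1) * (invMinus A B t - 1))
      t (Pi.single n 1) := by
  have h := hasLineDerivAt_ringInverse
    (hasLineDerivAt_sub (hasLineDerivAt_const (1 : 𝒜)) (hasLineDerivAt_solitonL A B n t)) ht.1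
  have h' : solitonL A B t * invMinus A B t = invMinus A B t - 1 := by
    rw [← mul_invMinus ht]
    noncomm_ring
  convert! h using 1
  rw [← h', invMinus]
  noncomm_ring

theorem hasLineDerivAt_invPlus {A B : 𝒜} {t : Fin N → ℝ} (ht : t ∈ solitonDomain A B N)
    (n : Fin N) :
    HasLineDerivAt ℝ (invPlus A B) (invPlus A B t * A ^ (2 * (n : ℕ) + 1) * (invPlus A B t - 1))
      t (Pi.single n 1) := by
  have h := hasLineDerivAt_ringInverse
    (hasLineDerivAt_add (hasLineDerivAt_const (1 : 𝒜)) (hasLineDerivAt_solitonL A B n t)) ht.2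
  have h' : -(solitonL A B t * invPlus A B t) = invPlus A B t - 1 := by
    rw [← mul_invPlus ht]
    noncomm_ring
  convert! h using 1
  rw [← h', invPlus]
  noncomm_ring

/-- The bracket is Q_t Q⁻¹, arranged by means of Q⁻¹ = (I + L)⁻¹ A (I - L) so as to match
`dressed_entry`. -/
theorem pderiv_solitonQ {t : Fin N → ℝ} (ht : t ∈ solitonDomain (A : 𝒜) B N) (n : Fin N) :
    pderiv n (solitonQ A B) t =
      (invMinus (A : 𝒜) B t * (A : 𝒜) ^ (2 * (n : ℕ) + 1) -
        invMinus (A : 𝒜) B t * (A : 𝒜) ^ (2 * (n : ℕ)) * invPlus (A : 𝒜) B t * A *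
          (1 - solitonL (A : 𝒜) B t)) * solitonQ A B t := by
  have h := hasLineDerivAt_mul (hasLineDerivAt_mul (hasLineDerivAt_invMinus ht n)
    (hasLineDerivAt_const ((A⁻¹ : 𝒜ˣ) : 𝒜)))
    (hasLineDerivAt_add (hasLineDerivAt_const (1 : 𝒜)) (hasLineDerivAt_solitonL (A : 𝒜) B n t))
  refine h.lineDeriv.trans ?_
  set L := solitonL (A : 𝒜) B t with hL
  have h1 : (1 - L) * invMinus (A : 𝒜) B t = 1 := mul_invMinus ht
  have h2 : invPlus (A : 𝒜) B t * (1 + L) = 1 := invPlus_mul ht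
  change _ = _ * (invMinus (A : 𝒜) B t * ((A⁻¹ : 𝒜ˣ) : 𝒜) * (1 + L))
  set R := invMinus (A : 𝒜) B t
  set S := invPlus (A : 𝒜) B t
  have h3 : R * (A : 𝒜) ^ (2 * (n : ℕ)) * S * A * (1 - L) * (R * ((A⁻¹ : 𝒜ˣ) : 𝒜) * (1 + L)) =
      R * (A : 𝒜) ^ (2 * (n : ℕ)) := by
    rw [mul_assoc R _ (1 + L), ← mul_assoc _ R, mul_assoc _ (1 - L) R, h1, mul_one, ← mul_assoc,
      mul_assoc _ (A : 𝒜), Units.mul_inv, mul_one, mul_assoc, h2, mul_one]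
  have h4 : ((A⁻¹ : 𝒜ˣ) : 𝒜) * (A : 𝒜) ^ (2 * (n : ℕ) + 1) = (A : 𝒜) ^ (2 * (n : ℕ)) := by
    rw [pow_succ', ← mul_assoc, Units.inv_mul, one_mul]
  have h5 : (A : 𝒜) ^ (2 * (n : ℕ) + 1) * ((A⁻¹ : 𝒜ˣ) : 𝒜) = (A : 𝒜) ^ (2 * (n : ℕ)) := by
    rw [pow_succ, mul_assoc, Units.mul_inv, mul_one]
  rw [sub_mul _ _ (R * _ * _), h3, zero_add, mul_zero, add_zero, mul_sub, mul_one, sub_mul, sub_mul,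
    mul_assoc R (_ ^ _) ((A⁻¹ : 𝒜ˣ) : 𝒜), h5, ← mul_assoc (R * _) _ L, mul_assoc R _ (_ ^ _), h4]
  noncomm_ring

/-! ### The soliton as a dressed resolvent -/

omit [NormedAlgebra ℝ 𝒜] [CompleteSpace 𝒜] in
theorem swap_mul_offDiag (A : 𝒜) : swap 𝒜 * !![0, A; A, 0] = !![0, A; A, 0] * swap 𝒜 := by
  simp [swap]

omit [NormedAlgebra ℝ 𝒜] [CompleteSpace 𝒜] in
theorem offDiag_pow (A : 𝒜) (n : ℕ) :
    !![0, A; A, 0] ^ (2 * n) = !![A ^ (2 * n), 0; 0, A ^ (2 * n)] := by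
  induction n with
  | zero => simp [Matrix.one_fin_two]
  | succ n ih => simp [mul_add, pow_succ, ih, mul_assoc]

/-- The matrix `diag (I - L, I + L)`. -/
noncomputable def diagL (A B : 𝒜) (t : Fin N → ℝ) : Matrix (Fin 2) (Fin 2) 𝒜 :=
  !![1 - solitonL A B t, 0; 0, 1 + solitonL A B t]

/-- The inverse of `diag (I - L, I + L)`. -/
noncomputable def diagInv (A B : 𝒜) (t : Fin N → ℝ) : Matrix (Fin 2) (Fin 2) 𝒜 :=
  !![invMinus A B t, 0; 0, invPlus A B t]

omit [CompleteSpace 𝒜] in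
theorem dressed_entry (A B : 𝒜) (t : Fin N → ℝ) (n : ℕ) :
    dressed (swap 𝒜) !![0, A; A, 0] (diagL A B t) (diagInv A B t) (2 * n) 0 0 =
      invMinus A B t * A ^ (2 * n + 1) -
        invMinus A B t * A ^ (2 * n) * invPlus A B t * A * (1 - solitonL A B t) := by
  rw [dressed, offDiag_pow]
  simp [diagL, diagInv, swap, mul_sub, pow_succ, mul_assoc]

-- The diagonal entries are opposite by (I - L)⁻¹ + (I + L)⁻¹ = 2 (I - L)⁻¹ (I + L)⁻¹. This matches
-- diag(V, -V) and starts the induction in `eval_resolvent`.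
omit [CompleteSpace 𝒜] in
theorem dressed_zero {A B : 𝒜} {t : Fin N → ℝ} (ht : t ∈ solitonDomain A B N) :
    dressed (swap 𝒜) !![0, A; A, 0] (diagL A B t) (diagInv A B t) 0 =
      !![invMinus A B t * A - invMinus A B t * invPlus A B t * A * (1 - solitonL A B t), 0;
        0, -(invMinus A B t * A - invMinus A B t * invPlus A B t * A * (1 - solitonL A B t))] := by
  have h : invPlus A B t * A - invPlus A B t * invMinus A B t * A * (1 + solitonL A B t) =
      -(invMinus A B t * A - invMinus A B t * invPlus A B t * A * (1 - solitonL A B t)) := by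
    rw [← invMinus_mul_invPlus_comm, ← sub_eq_zero]
    have := congrArg (· * A) (invMinus_add_invPlus ht)
    simp only [add_mul] at this
    linear_combination (norm := noncomm_ring) this
  rw [← h, dressed]
  ext i j
  fin_cases i <;> fin_cases j <;> simp [diagL, diagInv, swap, mul_sub, mul_assoc]

theorem hasMatrixLineDerivAt_diagL [NeZero N] (A B : 𝒜) (t : Fin N → ℝ) :
    HasMatrixLineDerivAt (diagL A B) (!![0, A; A, 0] * swap 𝒜 * (diagL A B t - 1)) t
      (Pi.single 0 1) := by
  have hL := hasLineDerivAt_solitonL A B 0 t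
  simp only [Fin.val_zero, mul_zero, zero_add, pow_one] at hL
  have hm := hasLineDerivAt_sub (hasLineDerivAt_const (1 : 𝒜)) hL
  have hp := hasLineDerivAt_add (hasLineDerivAt_const (1 : 𝒜)) hL
  intro i j
  fin_cases i <;> fin_cases j
  · convert! hm using 1
    simp [diagL, swap, Matrix.one_fin_two]
  · convert! hasLineDerivAt_const (0 : 𝒜) using 1
    simp [diagL, swap, Matrix.one_fin_two]
  · convert! hasLineDerivAt_const (0 : 𝒜) using 1
    simp [diagL, swap, Matrix.one_fin_two]
  · convert! hp using 1
    simp [diagL, swap, Matrix.one_fin_two]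

theorem hasMatrixLineDerivAt_diagInv [NeZero N] {A B : 𝒜} {t : Fin N → ℝ}
    (ht : t ∈ solitonDomain A B N) :
    HasMatrixLineDerivAt (diagInv A B)
      (diagInv A B t * !![0, A; A, 0] * swap 𝒜 * (diagInv A B t - 1)) t (Pi.single 0 1) := by
  have hm := hasLineDerivAt_invMinus ht 0
  have hp := hasLineDerivAt_invPlus ht 0
  simp only [Fin.val_zero, mul_zero, zero_add, pow_one] at hm hp
  intro i j
  fin_cases i <;> fin_cases j
  · convert! hm using 1
    simp [diagInv, swap, Matrix.one_fin_two]
  · convert! hasLineDerivAt_const (0 : 𝒜) using 1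
    simp [diagInv, swap, Matrix.one_fin_two]
  · convert! hasLineDerivAt_const (0 : 𝒜) using 1
    simp [diagInv, swap, Matrix.one_fin_two]
  · convert! hp using 1
    simp [diagInv, swap, Matrix.one_fin_two]

omit [CompleteSpace 𝒜] in
theorem isUnit_solitonQ {t : Fin N → ℝ} (ht : t ∈ solitonDomain (A : 𝒜) B N) :
    IsUnit (solitonQ A B t) :=
  ((isUnit_ringInverse.2 ht.1).mul A⁻¹.isUnit).mul ht.2

theorem isSolutionOn_solitonQ [NeZero N] :
    IsSolutionOn (fun n => resolvent (2 * n) 0 0 * q 0) (solitonDomain (A : 𝒜) B N)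
      (solitonQ A B) := by
  classical
  refine ⟨isOpen_solitonDomain _ _, contDiffOn_solitonQ A B, fun t ht => ?_⟩
  -- The value 1 off the domain is immaterial: the domain is open, and only values near its points
  -- are used.
  let u : (Fin N → ℝ) → 𝒜ˣ := fun t =>
    if h : t ∈ solitonDomain (A : 𝒜) B N then (isUnit_solitonQ A B h).unit else 1
  have hu : ∀ t ∈ solitonDomain (A : 𝒜) B N, (u t : 𝒜) = solitonQ A B t := fun t ht => by
    simp only [u, dif_pos ht, IsUnit.unit_spec]
  refine ⟨u t, hu t ht, fun n => ?_⟩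
  have key := eval_resolvent (isOpen_solitonDomain (A : 𝒜) B) (contDiffOn_solitonQ A B) hu 0
    (H := !![0, (A : 𝒜); (A : 𝒜), 0]) (swap_mul_offDiag _)
    (a := diagL (A : 𝒜) B) (R := diagInv (A : 𝒜) B)
    (fun t ht => by
      simp [diagL, diagInv, invMinus_mul ht, invPlus_mul ht, Matrix.one_fin_two])
    (fun t ht => by
      simp [diagL, diagInv, mul_invMinus ht, mul_invPlus ht, Matrix.one_fin_two])
    (fun t ht => by
      ext i j
      fin_cases i <;> fin_cases j <;> simp [diagL, swap, Matrix.ofNat_apply] <;>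
        rw [← one_add_one_eq_two] <;> abel)
    (fun t _ => hasMatrixLineDerivAt_diagL _ B t)
    (fun t ht => hasMatrixLineDerivAt_diagInv ht)
    (fun t ht => by
      have hV : eval (u t) (fun j => ((pderiv 0)^[j] (solitonQ A B)) t) V =
          invMinus (A : 𝒜) B t * A - invMinus (A : 𝒜) B t * invPlus (A : 𝒜) B t * A *
            (1 - solitonL (A : 𝒜) B t) := by
        rw [V, map_mul, eval_q_succ, eval_qinv]
        change pderiv 0 (solitonQ A B) t * _ = _
        rw [pderiv_solitonQ A B ht, ← hu t ht, mul_assoc, Units.mul_inv, mul_one]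
        simp
      rw [dressed_zero ht, ← hV, resolvent_zero]
      ext i j
      fin_cases i <;> fin_cases j <;> simp)
    (2 * (n : ℕ)) t ht
  have h := congrFun (congrFun key 0) 0
  rw [dressed_entry] at h
  rw [map_mul, eval_q_zero, pderiv_solitonQ A B ht n, hu t ht, ← h]
  rfl

end Soliton

end MetaMKdV

theorem theorem13 {𝒜 : Type*} [NormedRing 𝒜] [NormedAlgebra ℝ 𝒜] [CompleteSpace 𝒜]
    (A : 𝒜ˣ) (B : 𝒜) :
    (∃! K : ℕ → MetaMKdV.DiffPoly, MetaMKdV.IsHierarchy K) ∧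
    ∀ K : ℕ → MetaMKdV.DiffPoly, MetaMKdV.IsHierarchy K →
      ∀ (N : ℕ) [NeZero N],
        MetaMKdV.IsSolutionOn K (MetaMKdV.solitonDomain (A : 𝒜) B N)
          (MetaMKdV.solitonQ A B) := by
  refine ⟨⟨_, MetaMKdV.isHierarchy_resolvent, fun K hK =>
    hK.unique MetaMKdV.isHierarchy_resolvent⟩, fun K hK N _ => ?_⟩
  rw [hK.unique MetaMKdV.isHierarchy_resolvent]
  exact MetaMKdV.isSolutionOn_solitonQ A B
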